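/- Let $n\ge 2$ and let $\mathbb{R}_n$ be the real Clifford algebra generated by $e_1,\dots,e_n$ with $e_i^2=-1$, $e_ie_j=-e_je_i$ ($i\ne j$). It has the basis $e_A=e_{i_1}\cdots e_{i_r}$, $A=\{i_1<\dots<i_r\}\subseteq\{1,\dots,n\}$, the norm $|\sum_A x_Ae_A|=(\sum_A x_A^2)^{1/2}$, and the conjugation $a\mapsto\overline a$ with $\overline{e_i}=-e_i$, $\overline{ab}=\overline b\,\overline a$. Points $x\in\mathbb{R}^n$ are identified with $\sum_i x_ie_i$, and points $s=(s_0,\underline s)=(s_0,s_1,\dots,s_n)\in\mathbb{R}^{n+1}$ with paravectors $s_0+\sum_i s_ie_i$, so that $|s|^2=s_0^2+|\underline s|^2$. Let $\Omega\subset\mathbb{R}^n$ be a bounded open set with smooth boundary, and suppose that there are constants $0\le m<M<\infty$ with $\inf_{x\in\Omega}|x|=m$ and $\sup_{x\in\Omega}|x|=M$. For $\mathbb{R}_n$-valued functions on $\Omega$ put $\langle F,G\rangle_2=\int_\Omega\overline{F}\,G\,dx$, $\|F\|_2=(\int_\Omega|F|^2dx)^{1/2}$ and $\|F\|_D=(\sum_{i=1}^n\|\partial_{x_i}F\|_2^2)^{1/2}$.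 Let $L^2(\Omega)=L^2(\Omega,\mathbb{R}_n)$, let $H^1(\Omega)$ be the Sobolev space of all $F\in L^2(\Omega)$ with weak derivatives $\partial_{x_i}F\in L^2(\Omega)$, with norm $(\|F\|_2^2+\|F\|_D^2)^{1/2}$, and let $H^1_0(\Omega)$ be the closure of $C_c^\infty(\Omega,\mathbb{R}_n)$ in $H^1(\Omega)$. Let $$\mathcal{D}_e=\sum_{i=1}^n e_i\partial_{x_i},\qquad E=\sum_{i=1}^n x_i\partial_{x_i},\qquad \mathcal{D}_S=(1+|x|^2)\mathcal{D}_e-nx,$$ and, for $F,G\in H^1_0(\Omega)$, let $$\begin{aligned}q_s(F,G)=&\sum_{i=1}^n\langle(1+|x|^2)^2\partial_{x_i}F,\partial_{x_i}G\rangle_2+2(2+n)\langle(1+|x|^2)EF,G\rangle_2+2\langle(1+|x|^2)\,x\,\mathcal{D}_eF,G\rangle_2\\&-2s_0\langle\mathcal{D}_SF,G\rangle_2+(|s|^2+n^2)\langle F,G\rangle_2,\end{aligned}$$ the sesquilinear form of the Dirichlet problem for $Q_s(\mathcal{D}_S)=\mathcal{D}_S^2-2s_0\mathcal{D}_S+|s|^2$.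 **Theorem.** Let $s\in\mathbb{R}^{n+1}$ satisfy $$|s|^2+n^2-2|s_0|nM+(1+m^2)^2>0$$ and $$\begin{aligned}&|\underline s|^2(1+m^2)^2-s_0^2\big(n(1+M^2)^2-(1+m^2)^2\big)-2nM\big((3+n)(1+M^2)^2+(1+m^2)^2\big)|s_0|\\&\qquad>n(3+n)^2M^2(1+M^2)^2-n^2(1+m^2)^2.\end{aligned}$$ Then the number $$\begin{aligned}H_{n,m,M}(s)=&\tfrac12\big(|s|^2+n^2-2|s_0|nM+(1+m^2)^2\big)\\&-\tfrac12\sqrt{\big(|s|^2+n^2-2|s_0|nM-(1+m^2)^2\big)^2+4\big(\sqrt n\,(1+M^2)\big((3+n)M+|s_0|\big)\big)^2}\end{aligned}$$ is positive, and for every $f\in L^2(\Omega)$ there is a unique $F_f\in H^1_0(\Omega)$ such that $$q_s(F_f,G)=\langle f,G\rangle_2\qquad\text{for all }G\in H^1_0(\Omega).$$ Moreover, $$\|F_f\|_2\le\frac{1}{H_{n,m,M}(s)}\|f\|_2\qquad\text{and}\qquad\|F_f\|_D\le\frac{1}{H_{n,m,M}(s)}\|f\|_2 .$$ -/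

import Mathlib

open MeasureTheory Module
open scoped ContDiff InnerProductSpace

noncomputable section

namespace SphericalDirac

/-! ### The Clifford algebra `ℝ_n` with its coefficient norm -/

/-- Euclidean space `ℝⁿ`. -/
abbrev E (n : ℕ) : Type := EuclideanSpace ℝ (Fin n)

/-- The quadratic form `x ↦ -|x|²` on `ℝⁿ`. -/
def negSq (n : ℕ) : QuadraticForm ℝ (E n) :=
  -(LinearMap.BilinMap.toQuadraticMap (innerₗ (E n)))

theorem negSq_apply (n : ℕ) (x : E n) : negSq n x = -‖x‖ ^ 2 := by
  simp [negSq]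

/-- The real Clifford algebra `ℝ_n`, with `e_i ^ 2 = -1` and `e_i e_j = - e_j e_i` for `i ≠ j`.
Its `star` is the Clifford conjugation, `star (e_i) = - e_i` and `star (a * b) = star b * star a`. -/
abbrev Cl (n : ℕ) : Type := CliffordAlgebra (negSq n)

/-- The vector `x = ∑ i, x_i e_i` of `ℝⁿ`, as an element of `ℝ_n`. -/
abbrev vec {n : ℕ} (x : E n) : Cl n := CliffordAlgebra.ι (negSq n) x

/-- The imaginary unit `e_i`. -/
def unit {n : ℕ} (i : Fin n) : Cl n := vec (EuclideanSpace.single i (1 : ℝ))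

theorem unit_mul_self {n : ℕ} (i : Fin n) : unit i * unit i = (-1 : Cl n) := by
  rw [unit, CliffordAlgebra.ι_sq_scalar, negSq_apply]
  simp

theorem unit_mul_unit_of_ne {n : ℕ} {i j : Fin n} (h : i ≠ j) :
    (unit i * unit j : Cl n) = -(unit j * unit i) := by
  rw [eq_neg_iff_add_eq_zero]
  unfold unit
  rw [CliffordAlgebra.ι_mul_ι_add_swap]
  have : QuadraticMap.polar (negSq n) (EuclideanSpace.single i (1 : ℝ))
      (EuclideanSpace.single j (1 : ℝ)) = 0 := by
    simp only [QuadraticMap.polar, negSq_apply]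
    have h1 := norm_add_sq_eq_norm_sq_add_norm_sq_real
      (x := (EuclideanSpace.single i (1 : ℝ) : E n)) (y := EuclideanSpace.single j (1 : ℝ))
      (by simp [EuclideanSpace.inner_single_left, h.symm])
    nlinarith
  rw [this, map_zero]

/-- The monomial `e_A = e_{i₁} ⋯ e_{i_r}` for `A = {i₁ < ⋯ < i_r}`. -/
def monomial {n : ℕ} (A : Finset (Fin n)) : Cl n :=
  (List.ofFn fun k : Fin A.card => unit (A.orderEmbOfFin rfl k)).prod

/-- The monomials `e_A` as a basis of `ℝ_n`, transported from the exterior algebra. -/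
def cliffBasis (n : ℕ) : Basis (Finset (Fin n)) ℝ (Cl n) :=
  ((EuclideanSpace.basisFun (Fin n) ℝ).toBasis.ExteriorAlgebra).map
    (CliffordAlgebra.equivExterior (negSq n)).symm

theorem contractLeft_prod {n : ℕ} {Q : QuadraticForm ℝ (E n)} (d : Dual ℝ (E n))
    (L : List (E n)) (h : ∀ v ∈ L, d v = 0) :
    CliffordAlgebra.contractLeft d (L.map (CliffordAlgebra.ι Q)).prod = 0 := by
  induction L with
  | nil => simp
  | cons a L ih =>
    rw [List.map_cons, List.prod_cons, CliffordAlgebra.contractLeft_ι_mul, ih, h a] <;> simp_all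

theorem changeForm_prod {n : ℕ} {Q Q' : QuadraticForm ℝ (E n)} {B : LinearMap.BilinForm ℝ (E n)}
    (h : B.toQuadraticMap = Q' - Q) (L : List (E n)) (hL : L.Pairwise fun v w => B v w = 0) :
    CliffordAlgebra.changeForm h (L.map (CliffordAlgebra.ι Q)).prod =
      (L.map (CliffordAlgebra.ι Q')).prod := by
  induction L with
  | nil => simp
  | cons a L ih =>
    rw [List.pairwise_cons] at hL
    rw [List.map_cons, List.prod_cons, CliffordAlgebra.changeForm_ι_mul, ih hL.2,
      contractLeft_prod _ _ hL.1]
    simp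

theorem cliffBasis_apply {n : ℕ} (A : Finset (Fin n)) : cliffBasis n A = monomial A := by
  set v : Fin A.card → E n := fun k => EuclideanSpace.single (A.orderEmbOfFin rfl k) (1 : ℝ) with hv
  have h1 : (EuclideanSpace.basisFun (Fin n) ℝ).toBasis.ExteriorAlgebra A =
      ((List.ofFn v).map (CliffordAlgebra.ι (0 : QuadraticForm ℝ (E n)))).prod := by
    rw [ExteriorAlgebra.basis_apply_ofCard _ rfl, ExteriorAlgebra.ιMulti_family,
      ExteriorAlgebra.ιMulti_apply, List.map_ofFn]
    congr 1
    congr 1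
    funext k
    simp [hv, Set.powersetCard.ofFinEmbEquiv_symm_apply]
  have h2 : monomial A = ((List.ofFn v).map (CliffordAlgebra.ι (negSq n))).prod := by
    simp [monomial, hv, List.map_ofFn, Function.comp_def, unit]
  rw [cliffBasis, Basis.map_apply, h1, h2, CliffordAlgebra.equivExterior,
    CliffordAlgebra.changeFormEquiv_symm, CliffordAlgebra.changeFormEquiv_apply]
  apply changeForm_prod
  rw [List.pairwise_ofFn]
  intro i j hij
  have : A.orderEmbOfFin rfl i ≠ A.orderEmbOfFin rfl j := by simpa using hij.ne
  simp [hv, negSq, QuadraticMap.associated_apply, inner_add_right,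
    EuclideanSpace.inner_single_left, this, this.symm]

/-- The coefficients `(x_A)` of `x = ∑ x_A e_A`, as a vector of the Euclidean space `ℝ^(2ⁿ)`. -/
def coeffs (n : ℕ) : Cl n ≃ₗ[ℝ] EuclideanSpace ℝ (Finset (Fin n)) :=
  (cliffBasis n).equivFun.trans (WithLp.linearEquiv 2 ℝ (Finset (Fin n) → ℝ)).symm

/-- The norm `|x| = (∑ x_A²)^(1/2)` on `ℝ_n`. -/
instance instNormedAddCommGroupCl (n : ℕ) : NormedAddCommGroup (Cl n) :=
  NormedAddCommGroup.induced (Cl n) (EuclideanSpace ℝ (Finset (Fin n))) (coeffs n)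
    (coeffs n).injective

/-- The inner product `∑ x_A y_A` on `ℝ_n`. -/
instance instInnerProductSpaceCl (n : ℕ) : InnerProductSpace ℝ (Cl n) where
  __ := NormedSpace.induced ℝ (Cl n) (EuclideanSpace ℝ (Finset (Fin n))) (coeffs n)
  inner x y := ⟪coeffs n x, coeffs n y⟫_ℝ
  norm_sq_eq_re_inner x := norm_sq_eq_re_inner (𝕜 := ℝ) (coeffs n x)
  conj_inner_symm x y := inner_conj_symm (𝕜 := ℝ) (coeffs n x) (coeffs n y)
  add_left x y z := by simp [inner_add_left]
  smul_left x y r := by simp [inner_smul_left]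

theorem norm_cl_eq {n : ℕ} (x : Cl n) :
    ‖x‖ = Real.sqrt (∑ A, ((cliffBasis n).repr x A) ^ 2) := by
  change ‖coeffs n x‖ = _
  rw [EuclideanSpace.norm_eq]
  simp [coeffs]

instance instFiniteDimensionalCl (n : ℕ) : FiniteDimensional ℝ (Cl n) :=
  (cliffBasis n).finiteDimensional_of_finite

instance instCompleteSpaceCl (n : ℕ) : CompleteSpace (Cl n) :=
  FiniteDimensional.complete ℝ (Cl n)

/-! ### Clifford valued `L²` and Sobolev spaces -/

/-- `L²(Ω, ℝ_n)`. -/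
abbrev L2 (n : ℕ) (Ω : Set (E n)) : Type := Lp (Cl n) 2 (volume.restrict Ω)

/-- The `ℝ_n`-valued sesquilinear form `⟨F, G⟩_2 = ∫_Ω conj(F) G dx`. -/
def pairing {n : ℕ} (Ω : Set (E n)) (F G : E n → Cl n) : Cl n :=
  ∫ x in Ω, star (F x) * G x

/-- The partial derivative `∂_{x_i} φ` of a differentiable function. -/
def partialDeriv {n : ℕ} {V : Type*} [NormedAddCommGroup V] [NormedSpace ℝ V]
    (i : Fin n) (φ : E n → V) (x : E n) : V :=
  fderiv ℝ φ x (EuclideanSpace.single i 1)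

/-- `φ ∈ C_c^∞(Ω, V)`. -/
structure IsTestFunction {n : ℕ} {V : Type*} [NormedAddCommGroup V] [NormedSpace ℝ V]
    (Ω : Set (E n)) (φ : E n → V) : Prop where
  contDiff : ContDiff ℝ ∞ φ
  hasCompactSupport : HasCompactSupport φ
  tsupport_subset : tsupport φ ⊆ Ω

/-- `g` is the `i`-th weak partial derivative of `u` in `Ω`. -/
def IsWeakPartial {n : ℕ} (Ω : Set (E n)) (i : Fin n) (u g : L2 n Ω) : Prop :=
  ∀ φ : E n → ℝ, IsTestFunction Ω φ →
    ∫ x in Ω, partialDeriv i φ x • u x = -∫ x in Ω, φ x • g x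

/-- Pairs `(u, (g_i)_i)` of elements of `L²(Ω, ℝ_n)`, with the norm
`(‖u‖_2² + ∑ i, ‖g_i‖_2²)^(1/2)`. -/
abbrev Jet (n : ℕ) (Ω : Set (E n)) : Type :=
  WithLp 2 (L2 n Ω × PiLp 2 fun _ : Fin n => L2 n Ω)

namespace Jet

variable {n : ℕ} {Ω : Set (E n)}

/-- The function `F` of the pair `p = (F, (∂_i F)_i)`. -/
def fn (p : Jet n Ω) : L2 n Ω := p.fst

/-- The `i`-th derivative `∂_{x_i} F` of the pair `p = (F, (∂_i F)_i)`. -/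
def grad (p : Jet n Ω) (i : Fin n) : L2 n Ω := p.snd i

end Jet

theorem IsTestFunction.memLp {n : ℕ} {Ω : Set (E n)} {φ : E n → ℝ} (h : IsTestFunction Ω φ) :
    MemLp φ 2 (volume.restrict Ω) :=
  (h.contDiff.continuous.memLp_of_hasCompactSupport h.hasCompactSupport).restrict Ω

theorem IsTestFunction.memLp_partialDeriv {n : ℕ} {Ω : Set (E n)} {φ : E n → ℝ}
    (h : IsTestFunction Ω φ) (i : Fin n) :
    MemLp (partialDeriv i φ) 2 (volume.restrict Ω) := by
  refine (Continuous.memLp_of_hasCompactSupport (μ := volume) ?_ ?_).restrict Ω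
  · exact (h.contDiff.continuous_fderiv (by simp)).clm_apply continuous_const
  · exact h.hasCompactSupport.fderiv_apply (𝕜 := ℝ) _

theorem integrable_smul_L2 {n : ℕ} {Ω : Set (E n)} {φ : E n → ℝ}
    (h : MemLp φ 2 (volume.restrict Ω)) (u : L2 n Ω) :
    Integrable (fun x => φ x • u x) (volume.restrict Ω) :=
  memLp_one_iff_integrable.1 ((Lp.memLp u).smul h)

/-- The Sobolev space `H¹(Ω, ℝ_n)`: the functions `F ∈ L²(Ω, ℝ_n)` with weak partial derivatives
`∂_{x_i} F ∈ L²(Ω, ℝ_n)`, each `F` being stored together with its (uniquely determined) weak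
derivatives, with the norm `(‖F‖_2² + ∑ i, ‖∂_{x_i} F‖_2²)^(1/2)`. -/
def H1 (n : ℕ) (Ω : Set (E n)) : Submodule ℝ (Jet n Ω) where
  carrier := {p | ∀ i, IsWeakPartial Ω i p.fn (p.grad i)}
  zero_mem' i φ hφ := by
    have h1 : (fun x => partialDeriv i φ x • (0 : L2 n Ω) x) =ᵐ[volume.restrict Ω] 0 := by
      filter_upwards [Lp.coeFn_zero (Cl n) 2 (volume.restrict Ω)] with x hx
      rw [hx]; simp
    have h2 : (fun x => φ x • (0 : L2 n Ω) x) =ᵐ[volume.restrict Ω] 0 := by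
      filter_upwards [Lp.coeFn_zero (Cl n) 2 (volume.restrict Ω)] with x hx
      rw [hx]; simp
    change ∫ x in Ω, partialDeriv i φ x • (0 : L2 n Ω) x = -∫ x in Ω, φ x • (0 : L2 n Ω) x
    rw [integral_congr_ae h1, integral_congr_ae h2]
    simp
  add_mem' {p q} hp hq i φ hφ := by
    have h1 : (fun x => partialDeriv i φ x • (p.fn + q.fn) x) =ᵐ[volume.restrict Ω]
        fun x => partialDeriv i φ x • p.fn x + partialDeriv i φ x • q.fn x := by
      filter_upwards [Lp.coeFn_add p.fn q.fn] with x hx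
      rw [hx, Pi.add_apply, smul_add]
    have h2 : (fun x => φ x • (p.grad i + q.grad i) x) =ᵐ[volume.restrict Ω]
        fun x => φ x • p.grad i x + φ x • q.grad i x := by
      filter_upwards [Lp.coeFn_add (p.grad i) (q.grad i)] with x hx
      rw [hx, Pi.add_apply, smul_add]
    change ∫ x in Ω, partialDeriv i φ x • (p.fn + q.fn) x =
      -∫ x in Ω, φ x • (p.grad i + q.grad i) x
    rw [integral_congr_ae h1, integral_congr_ae h2,
      integral_add (integrable_smul_L2 (hφ.memLp_partialDeriv i) _)
        (integrable_smul_L2 (hφ.memLp_partialDeriv i) _),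
      integral_add (integrable_smul_L2 hφ.memLp _) (integrable_smul_L2 hφ.memLp _),
      hp i φ hφ, hq i φ hφ, neg_add]
  smul_mem' c p hp i φ hφ := by
    have h1 : (fun x => partialDeriv i φ x • (c • p.fn) x) =ᵐ[volume.restrict Ω]
        fun x => c • partialDeriv i φ x • p.fn x := by
      filter_upwards [Lp.coeFn_smul c p.fn] with x hx
      rw [hx, Pi.smul_apply, smul_comm]
    have h2 : (fun x => φ x • (c • p.grad i) x) =ᵐ[volume.restrict Ω]
        fun x => c • φ x • p.grad i x := by
      filter_upwards [Lp.coeFn_smul c (p.grad i)] with x hx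
      rw [hx, Pi.smul_apply, smul_comm]
    change ∫ x in Ω, partialDeriv i φ x • (c • p.fn) x = -∫ x in Ω, φ x • (c • p.grad i) x
    rw [integral_congr_ae h1, integral_congr_ae h2, integral_smul, integral_smul, hp i φ hφ,
      smul_neg]

/-- An element of `H¹(Ω, ℝ_n)` is determined by the underlying function in `L²(Ω, ℝ_n)`. -/
theorem H1.ext_fn {n : ℕ} {Ω : Set (E n)} (hΩ : IsOpen Ω) {p q : H1 n Ω}
    (h : (p : Jet n Ω).fn = (q : Jet n Ω).fn) : p = q := by
  have key : ∀ i, (p : Jet n Ω).grad i = (q : Jet n Ω).grad i := by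
    intro i
    apply Lp.ext
    have hint : ∀ φ : E n → ℝ, IsTestFunction Ω φ →
        ∫ x in Ω, φ x • ((p : Jet n Ω).grad i x - (q : Jet n Ω).grad i x) = 0 := by
      intro φ hφ
      simp_rw [smul_sub]
      rw [integral_sub (integrable_smul_L2 hφ.memLp _) (integrable_smul_L2 hφ.memLp _)]
      have h1 := p.2 i φ hφ
      have h2 := q.2 i φ hφ
      rw [h, h2, neg_inj] at h1
      rw [h1, sub_self]
    have hloc : LocallyIntegrableOn
        (fun x => (p : Jet n Ω).grad i x - (q : Jet n Ω).grad i x) Ω volume := by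
      have : LocallyIntegrable
          (fun x => (p : Jet n Ω).grad i x - (q : Jet n Ω).grad i x) (volume.restrict Ω) :=
        ((Lp.memLp _).locallyIntegrable (by norm_num)).sub
          ((Lp.memLp _).locallyIntegrable (by norm_num))
      exact locallyIntegrableOn_of_locallyIntegrable_restrict this
    have := hΩ.ae_eq_zero_of_integral_contDiff_smul_eq_zero hloc
      (fun φ h1 h2 h3 => by
        rw [← hint φ ⟨h1, h2, h3⟩]
        refine (setIntegral_eq_integral_of_forall_compl_eq_zero fun x hx => ?_).symm
        rw [image_eq_zero_of_notMem_tsupport (fun h' => hx (h3 h')), zero_smul])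
    rw [Filter.EventuallyEq, ae_restrict_iff' hΩ.measurableSet]
    filter_upwards [this] with x hx hxΩ
    exact sub_eq_zero.1 (hx hxΩ)
  apply Subtype.ext
  apply WithLp.ofLp_injective
  refine Prod.ext h ?_
  apply WithLp.ofLp_injective
  funext i
  exact key i

theorem IsTestFunction.add {n : ℕ} {Ω : Set (E n)} {φ ψ : E n → Cl n}
    (hφ : IsTestFunction Ω φ) (hψ : IsTestFunction Ω ψ) : IsTestFunction Ω (φ + ψ) :=
  ⟨hφ.contDiff.add hψ.contDiff, hφ.hasCompactSupport.add hψ.hasCompactSupport,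
    (tsupport_add φ ψ).trans (Set.union_subset hφ.tsupport_subset hψ.tsupport_subset)⟩

theorem IsTestFunction.const_smul {n : ℕ} {Ω : Set (E n)} {φ : E n → Cl n} (c : ℝ)
    (hφ : IsTestFunction Ω φ) : IsTestFunction Ω (c • φ) :=
  ⟨contDiff_const.smul hφ.contDiff, hφ.hasCompactSupport.smul_left (f := fun _ => c),
    (tsupport_smul_subset_right (fun _ => c) φ).trans hφ.tsupport_subset⟩

/-- `C_c^∞(Ω, ℝ_n)` as a subspace of `H¹(Ω, ℝ_n)`. -/
def testSubspace (n : ℕ) (Ω : Set (E n)) : Submodule ℝ (H1 n Ω) where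
  carrier := {p | ∃ φ : E n → Cl n, IsTestFunction Ω φ ∧
    (p : Jet n Ω).fn =ᵐ[volume.restrict Ω] φ ∧
    ∀ i, (p : Jet n Ω).grad i =ᵐ[volume.restrict Ω] partialDeriv i φ}
  zero_mem' := by
    refine ⟨0, ⟨contDiff_const, HasCompactSupport.zero, by simp⟩, Lp.coeFn_zero _ _ _, fun i => ?_⟩
    refine (Lp.coeFn_zero _ _ _).trans (Filter.Eventually.of_forall fun x => ?_)
    simp [partialDeriv]
  add_mem' := by
    rintro p q ⟨φ, hφ, hp, hp'⟩ ⟨ψ, hψ, hq, hq'⟩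
    refine ⟨φ + ψ, hφ.add hψ, (Lp.coeFn_add _ _).trans (hp.add hq), fun i => ?_⟩
    refine (Lp.coeFn_add _ _).trans (((hp' i).add (hq' i)).trans
      (Filter.Eventually.of_forall fun x => ?_))
    simp only [partialDeriv, Pi.add_apply]
    rw [fderiv_add (hφ.contDiff.differentiable (by simp) x)
      (hψ.contDiff.differentiable (by simp) x)]
    rfl
  smul_mem' := by
    rintro c p ⟨φ, hφ, hp, hp'⟩
    refine ⟨c • φ, hφ.const_smul c, (Lp.coeFn_smul _ _).trans (hp.const_smul c), fun i => ?_⟩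
    refine (Lp.coeFn_smul _ _).trans (((hp' i).const_smul c).trans
      (Filter.Eventually.of_forall fun x => ?_))
    simp only [partialDeriv, Pi.smul_apply]
    rw [fderiv_const_smul (hφ.contDiff.differentiable (by simp) x)]
    rfl

/-- `H¹_0(Ω, ℝ_n)`, the closure of `C_c^∞(Ω, ℝ_n)` in `H¹(Ω, ℝ_n)`. -/
def H10 (n : ℕ) (Ω : Set (E n)) : Submodule ℝ (H1 n Ω) :=
  (testSubspace n Ω).topologicalClosure

/-- The `L²` norm `‖F‖_2` of `F ∈ H¹(Ω, ℝ_n)`. -/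
def normL2 {n : ℕ} {Ω : Set (E n)} (F : H1 n Ω) : ℝ := ‖(F : Jet n Ω).fn‖

/-- The Sobolev seminorm `‖F‖_D = (∑ i, ‖∂_{x_i} F‖_2²)^(1/2)` of `F ∈ H¹(Ω, ℝ_n)`. -/
def seminormD {n : ℕ} {Ω : Set (E n)} (F : H1 n Ω) : ℝ :=
  Real.sqrt (∑ i, ‖(F : Jet n Ω).grad i‖ ^ 2)

/-! ### The spherical Dirac operator and its sesquilinear form -/

/-- The Euclidean Dirac operator `D_e F = ∑ i, e_i ∂_{x_i} F`. -/
def eucDirac {n : ℕ} {Ω : Set (E n)} (F : H1 n Ω) (x : E n) : Cl n :=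
  ∑ i, unit i * (F : Jet n Ω).grad i x

/-- The Euler operator `E F = ∑ i, x_i ∂_{x_i} F`. -/
def euler {n : ℕ} {Ω : Set (E n)} (F : H1 n Ω) (x : E n) : Cl n :=
  ∑ i, x i • (F : Jet n Ω).grad i x

/-- The spherical Dirac operator `D_S F = (1 + |x|²) D_e F - n x F`. -/
def sphDirac {n : ℕ} {Ω : Set (E n)} (F : H1 n Ω) (x : E n) : Cl n :=
  (1 + ‖x‖ ^ 2) • eucDirac F x - (n : ℝ) • (vec x * (F : Jet n Ω).fn x)

/-- The sesquilinear form `q_s` of the Dirichlet problem for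
`Q_s(D_S) = D_S² - 2 s₀ D_S + |s|²`; the paravector `s = s₀ + s₁ e₁ + ⋯ + s_n e_n` is the point
`(s₀, s₁, …, s_n)` of `ℝ^(n+1)`. -/
def qForm {n : ℕ} {Ω : Set (E n)} (s : EuclideanSpace ℝ (Fin (n + 1))) (F G : H1 n Ω) : Cl n :=
  ∑ i, pairing Ω (fun x => (1 + ‖x‖ ^ 2) ^ 2 • (F : Jet n Ω).grad i x) ((G : Jet n Ω).grad i)
  + (2 * (2 + n) : ℝ) • pairing Ω (fun x => (1 + ‖x‖ ^ 2) • euler F x) (G : Jet n Ω).fn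
  + (2 : ℝ) • pairing Ω (fun x => (1 + ‖x‖ ^ 2) • (vec x * eucDirac F x)) (G : Jet n Ω).fn
  - (2 * s 0) • pairing Ω (sphDirac F) (G : Jet n Ω).fn
  + (‖s‖ ^ 2 + n ^ 2) • pairing Ω (F : Jet n Ω).fn (G : Jet n Ω).fn

/-- `F` is a weak solution in `H¹_0(Ω, ℝ_n)` of `Q_s(D_S) F = f`, `F = 0` on the boundary. -/
def IsWeakSolution {n : ℕ} {Ω : Set (E n)} (s : EuclideanSpace ℝ (Fin (n + 1))) (f : L2 n Ω)
    (F : H10 n Ω) : Prop :=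
  ∀ G : H10 n Ω, qForm s (F : H1 n Ω) (G : H1 n Ω) = pairing Ω f ((G : H1 n Ω) : Jet n Ω).fn

/-- `Ω` has smooth boundary: near each of its boundary points, `Ω` is the sublevel set `ρ < 0` of
a smooth function `ρ` without critical points. -/
def HasSmoothBoundary {n : ℕ} (Ω : Set (E n)) : Prop :=
  ∀ p ∈ frontier Ω, ∃ U : Set (E n), IsOpen U ∧ p ∈ U ∧ ∃ ρ : E n → ℝ,
    ContDiffOn ℝ ∞ ρ U ∧ (∀ x ∈ U, fderiv ℝ ρ x ≠ 0) ∧ Ω ∩ U = {x ∈ U | ρ x < 0}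

/-- The constant `H_{n,m,M}(s)`. -/
def constH (n : ℕ) (m M : ℝ) (s : EuclideanSpace ℝ (Fin (n + 1))) : ℝ :=
  (1 / 2) * (‖s‖ ^ 2 + n ^ 2 - 2 * |s 0| * n * M + (1 + m ^ 2) ^ 2)
  - (1 / 2) * Real.sqrt (((‖s‖ ^ 2 + n ^ 2 - 2 * |s 0| * n * M) - (1 + m ^ 2) ^ 2) ^ 2
      + 4 * (Real.sqrt n * (1 + M ^ 2) * ((3 + n) * M + |s 0|)) ^ 2)

end SphericalDirac

end

open scoped symmDiff

noncomputable section

namespace SphericalDirac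

/-! The proof is Lax–Milgram for the scalar part of `q_s`, with an explicit coercivity constant.

The scalar part `⟨1, ·⟩` of `star a * b` is the real inner product of `a` and `b`
(`inner_one_star_mul`), so the scalar part of `⟨F, G⟩_2` is the real `L²` inner product. The form
and the right-hand side are right linear over `ℝ_n` in `G`, and `H¹_0` is stable under `G ↦ G a`.
Testing with all `G a` therefore recovers the Clifford-valued equation from its scalar part
(`isWeakSolution_iff`).

Coercivity is a pointwise estimate of the integrand (`constH_mul_le_pointwise`). Multiplication by a
vector `x` is skew and scales norms by `|x|`, so the term `x F` of `D_S` disappears from the scalar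
part and the other first order terms are bounded by Cauchy–Schwarz. With `φ = |F|` and `γ = |∇F|`
there remains the lower bound `a φ² + b γ² - 2 c φ γ`, where `a = |s|² + n² - 2|s₀|nM`, `b =
(1+m²)²` and `c = √n (1+M²)((3+n)M + |s₀|)`. Its smaller eigenvalue is `H_{n,m,M}(s)`, and the two
hypotheses on `s` say that the trace `a + b` and the determinant `ab - c²` are positive.

Coercivity in the full `H¹` norm also yields both estimates, on testing the equation with the
solution itself. -/

/-! ### Left multiplication and the inner product of `ℝ_n` -/

theorem monomial_eq_of_sorted {n : ℕ} {l : List (Fin n)} (hl : l.Pairwise (· < ·)) :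
    monomial l.toFinset = (l.map unit).prod := by
  have hs : l.toFinset.sort (· ≤ ·) = l :=
    (List.toFinset_sort _ (hl.imp ne_of_lt)).2 (hl.imp le_of_lt)
  have h : (List.ofFn fun k : Fin l.toFinset.card => l.toFinset.orderEmbOfFin rfl k) = l := by
    refine (List.ext_getElem (by simp) fun k h1 h2 => ?_).trans hs
    simp [Finset.orderEmbOfFin_apply]
  conv_rhs => rw [← h, List.map_ofFn]
  rfl

/-- Left multiplication by `e_i` permutes the monomials up to sign. -/
theorem unit_mul_prod_sorted {n : ℕ} (i : Fin n) (l : List (Fin n)) (hl : l.Pairwise (· < ·)) :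
    ∃ l' : List (Fin n), l'.Pairwise (· < ·) ∧ l'.toFinset = l.toFinset ∆ {i} ∧
      ∃ ε : ℝ, ε * ε = 1 ∧ unit i * (l.map unit).prod = ε • ((l'.map unit).prod : Cl n) := by
  induction l with
  | nil => exact ⟨[i], by simp, by simp [symmDiff], 1, by simp, by simp⟩
  | cons a l ih =>
    have hl' := List.pairwise_cons.1 hl
    rcases lt_trichotomy i a with h | rfl | h
    · refine ⟨i :: a :: l, ?_, ?_, 1, by simp, by simp⟩
      · refine List.pairwise_cons.2 ⟨fun b hb => ?_, hl⟩
        rcases List.mem_cons.1 hb with rfl | hb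
        · exact h
        · exact h.trans (hl'.1 b hb)
      · ext b
        have h1 : i ∉ l := fun hb => absurd (hl'.1 i hb) (not_lt.2 h.le)
        have h2 := h.ne
        simp only [List.toFinset_cons, Finset.mem_insert, List.mem_toFinset, Finset.mem_symmDiff,
          Finset.mem_singleton]
        grind
    -- If `i` heads the list, `e_i e_i = -1` deletes it.
    · refine ⟨l, hl'.2, ?_, -1, by simp, ?_⟩
      · ext b
        have h1 : i ∉ l := fun hb => absurd (hl'.1 i hb) (lt_irrefl _)
        simp only [List.toFinset_cons, Finset.mem_insert, List.mem_toFinset, Finset.mem_symmDiff,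
          Finset.mem_singleton]
        grind
      · rw [List.map_cons, List.prod_cons, ← mul_assoc, unit_mul_self]
        simp
    -- If `i > a`, moving `e_i` past `e_a` flips the sign and leaves the shorter list.
    · obtain ⟨l', h1, h2, ε, h3, h4⟩ := ih hl'.2
      have hmem : ∀ b, b ∈ l' ↔ b ∈ l ∧ b ≠ i ∨ b = i ∧ b ∉ l := by
        intro b
        rw [← List.mem_toFinset, h2]
        simp [Finset.mem_symmDiff]
      refine ⟨a :: l', List.pairwise_cons.2 ⟨fun b hb => ?_, h1⟩, ?_, -ε, by simpa using h3, ?_⟩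
      · rcases (hmem b).1 hb with hb | hb
        · exact hl'.1 b hb.1
        · exact hb.1 ▸ h
      · ext b
        have h2 := h.ne
        simp only [List.toFinset_cons, Finset.mem_insert, List.mem_toFinset, Finset.mem_symmDiff,
          Finset.mem_singleton, hmem]
        grind
      · rw [List.map_cons, List.prod_cons, ← mul_assoc, unit_mul_unit_of_ne h.ne', neg_mul,
          mul_assoc, h4, List.map_cons, List.prod_cons, mul_smul_comm, neg_smul]

theorem unit_mul_monomial {n : ℕ} (i : Fin n) (A : Finset (Fin n)) :
    ∃ ε : ℝ, ε * ε = 1 ∧ unit i * monomial A = ε • monomial (A ∆ {i}) := by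
  obtain ⟨l', h1, h2, ε, h3, h4⟩ := unit_mul_prod_sorted i (A.sort (· ≤ ·))
    (by simpa using A.sortedLT_sort.pairwise)
  refine ⟨ε, h3, ?_⟩
  have hA := monomial_eq_of_sorted (l := A.sort (· ≤ ·)) (by simpa using A.sortedLT_sort.pairwise)
  rw [Finset.sort_toFinset] at hA h2
  rw [hA, h4, ← h2, monomial_eq_of_sorted h1]

theorem inner_monomial {n : ℕ} (A B : Finset (Fin n)) :
    ⟪(monomial A : Cl n), monomial B⟫_ℝ = if A = B then 1 else 0 := by
  change ⟪coeffs n (monomial A), coeffs n (monomial B)⟫_ℝ = _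
  rw [← cliffBasis_apply, ← cliffBasis_apply]
  simp [coeffs, PiLp.inner_apply, Finsupp.single_apply, eq_comm]

/-- The monomials are orthonormal and `A ↦ A ∆ {i}` is injective, so `unit_mul_monomial` makes
multiplication by `e_i` a signed permutation of an orthonormal basis. -/
theorem inner_unit_mul_unit_mul {n : ℕ} (i : Fin n) (a b : Cl n) :
    ⟪unit i * a, unit i * b⟫_ℝ = ⟪a, b⟫_ℝ := by
  have h : (innerₗ (Cl n)).compl₁₂ (LinearMap.mulLeft ℝ (unit i)) (LinearMap.mulLeft ℝ (unit i)) =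
      innerₗ (Cl n) := by
    refine LinearMap.BilinForm.ext_basis (cliffBasis n) fun A B => ?_
    simp only [LinearMap.compl₁₂_apply, LinearMap.mulLeft_apply, innerₗ_apply_apply,
      cliffBasis_apply]
    obtain ⟨ε, h1, h2⟩ := unit_mul_monomial i A
    obtain ⟨δ, h3, h4⟩ := unit_mul_monomial i B
    rw [h2, h4, inner_smul_left, inner_smul_right, inner_monomial, inner_monomial]
    by_cases hAB : A = B
    · subst hAB
      have : ε = δ := by
        have h5 := h2.symm.trans h4
        have h6 : (monomial (A ∆ {i}) : Cl n) ≠ 0 := by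
          rw [← cliffBasis_apply]; exact (cliffBasis n).ne_zero _
        exact smul_left_injective ℝ h6 h5
      subst this
      simp [h1]
    · have : A ∆ {i} ≠ B ∆ {i} := fun h => hAB (symmDiff_left_injective _ h)
      simp [hAB, this]
  exact LinearMap.congr_fun₂ h a b

/-- An isometry whose square is `-1` is skew. -/
theorem inner_unit_mul_left {n : ℕ} (i : Fin n) (a b : Cl n) :
    ⟪unit i * a, b⟫_ℝ = -⟪a, unit i * b⟫_ℝ := by
  rw [← inner_unit_mul_unit_mul i a, ← mul_assoc, unit_mul_self]
  simp

theorem vec_eq_sum {n : ℕ} (x : E n) : vec x = ∑ i, x i • (unit i : Cl n) := by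
  have h : x = ∑ i, x i • EuclideanSpace.single i (1 : ℝ) := by
    ext j
    simp [Pi.single_apply]
  conv_lhs => rw [h]
  simp [unit]

theorem inner_vec_mul_left {n : ℕ} (x : E n) (a b : Cl n) :
    ⟪vec x * a, b⟫_ℝ = -⟪a, vec x * b⟫_ℝ := by
  simp only [vec_eq_sum, Finset.sum_mul, sum_inner, inner_sum, smul_mul_assoc, inner_smul_left,
    inner_smul_right, inner_unit_mul_left]
  simp

/-- Left multiplication by `star c` is adjoint to left multiplication by `c`. -/
theorem inner_mul_left_eq {n : ℕ} (c a b : Cl n) : ⟪c * a, b⟫_ℝ = ⟪a, star c * b⟫_ℝ := by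
  induction c using CliffordAlgebra.induction generalizing a b with
  | algebraMap r =>
    rw [CliffordAlgebra.star_algebraMap, ← Algebra.smul_def, ← Algebra.smul_def, inner_smul_left,
      inner_smul_right]
    simp
  | ι x => rw [CliffordAlgebra.star_ι, neg_mul, inner_neg_right]; exact inner_vec_mul_left x a b
  | mul c d hc hd => rw [mul_assoc, hc, hd, star_mul, mul_assoc]
  | add c d hc hd => rw [add_mul, inner_add_left, hc, hd, star_add, add_mul, inner_add_right]

theorem inner_one_star_mul {n : ℕ} (a b : Cl n) : ⟪(1 : Cl n), star a * b⟫_ℝ = ⟪a, b⟫_ℝ := by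
  rw [← inner_mul_left_eq, mul_one]

/-- Skewness together with `x² = -|x|²`. For general elements of `ℝ_n` the norm is not
multiplicative. -/
theorem norm_vec_mul {n : ℕ} (x : E n) (a : Cl n) : ‖vec x * a‖ = ‖x‖ * ‖a‖ := by
  have h : ‖vec x * a‖ ^ 2 = (‖x‖ * ‖a‖) ^ 2 := by
    rw [← real_inner_self_eq_norm_sq, inner_vec_mul_left, ← mul_assoc,
      CliffordAlgebra.ι_sq_scalar, ← Algebra.smul_def, inner_smul_right, negSq_apply,
      real_inner_self_eq_norm_sq]
    ring
  exact (sq_eq_sq₀ (norm_nonneg _) (by positivity)).1 h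

theorem norm_unit_mul {n : ℕ} (i : Fin n) (a : Cl n) : ‖unit i * a‖ = ‖a‖ := by
  simp [unit, norm_vec_mul]

/-- An element of `ℝ_n` is determined by the scalar parts of its right multiples. -/
theorem eq_of_inner_one_mul {n : ℕ} {u v : Cl n}
    (h : ∀ a, ⟪(1 : Cl n), u * a⟫_ℝ = ⟪(1 : Cl n), v * a⟫_ℝ) : u = v := by
  apply star_injective
  refine ext_inner_right ℝ fun a => ?_
  rw [← inner_one_star_mul, ← inner_one_star_mul (star v), star_star, star_star, h]

/-- Multiplication of `ℝ_n` as a continuous bilinear map. -/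
def mulCLM (n : ℕ) : Cl n →L[ℝ] Cl n →L[ℝ] Cl n :=
  (LinearMap.mul ℝ (Cl n)).toContinuousBilinearMap

@[simp] theorem mulCLM_apply {n : ℕ} (a b : Cl n) : mulCLM n a b = a * b := rfl

/-- The conjugation of `ℝ_n` as a continuous linear map. -/
def starCLM (n : ℕ) : Cl n →L[ℝ] Cl n :=
  LinearMap.toContinuousLinearMap
    { toFun := star, map_add' := star_add, map_smul' := fun r a => CliffordAlgebra.star_smul r a }

@[simp] theorem starCLM_apply {n : ℕ} (a : Cl n) : starCLM n a = star a := rfl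

instance instContinuousMulCl (n : ℕ) : ContinuousMul (Cl n) :=
  ⟨(mulCLM n).continuous₂⟩

theorem continuous_vec {n : ℕ} : Continuous fun x : E n => (vec x : Cl n) :=
  LinearMap.continuous_of_finiteDimensional (CliffordAlgebra.ι (negSq n))

/-! ### The pairing on `L²` -/

/-- The pairing `⟨u, v⟩_2` as a continuous bilinear map on `L²(Ω, ℝ_n)`. -/
def pairL (n : ℕ) (Ω : Set (E n)) : L2 n Ω →L[ℝ] L2 n Ω →L[ℝ] Cl n :=
  (mulCLM n ∘L starCLM n).lpPairing (volume.restrict Ω) 2 2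

theorem pairing_eq_pairL {n : ℕ} {Ω : Set (E n)} (u v : L2 n Ω) :
    pairing Ω u v = pairL n Ω u v := by
  rw [pairL, ContinuousLinearMap.lpPairing_eq_integral]
  rfl

theorem pairing_congr_left {n : ℕ} {Ω : Set (E n)} {F F' : E n → Cl n} (G : E n → Cl n)
    (h : F =ᵐ[volume.restrict Ω] F') : pairing Ω F G = pairing Ω F' G := by
  refine integral_congr_ae ?_
  filter_upwards [h] with x hx
  rw [hx]

theorem integrable_star_mul {n : ℕ} {Ω : Set (E n)} (u v : L2 n Ω) :
    Integrable (fun x => star (u x) * v x) (volume.restrict Ω) :=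
  memLp_one_iff_integrable.1
    ((mulCLM n ∘L starCLM n).memLp_of_bilin 1 (Lp.memLp u) (Lp.memLp v))

theorem inner_one_pairL {n : ℕ} {Ω : Set (E n)} (u v : L2 n Ω) :
    ⟪(1 : Cl n), pairL n Ω u v⟫_ℝ = ⟪u, v⟫_ℝ := by
  rw [← pairing_eq_pairL, pairing, L2.inner_def, ← integral_inner (integrable_star_mul u v)]
  simp only [inner_one_star_mul]

/-! ### Right multiplication -/

/-- Right multiplication by `a ∈ ℝ_n` on `L²(Ω, ℝ_n)`. -/
def rightMul {n : ℕ} (Ω : Set (E n)) (a : Cl n) : L2 n Ω →L[ℝ] L2 n Ω :=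
  ((mulCLM n).flip a).compLpL 2 (volume.restrict Ω)

theorem coeFn_rightMul {n : ℕ} {Ω : Set (E n)} (a : Cl n) (u : L2 n Ω) :
    rightMul Ω a u =ᵐ[volume.restrict Ω] fun x => u x * a :=
  ContinuousLinearMap.coeFn_compLpL _ _

/-- Right linearity in the second argument, which lets the scalar part of the pairing determine the
whole. -/
theorem pairL_rightMul {n : ℕ} {Ω : Set (E n)} (a : Cl n) (u v : L2 n Ω) :
    pairL n Ω u (rightMul Ω a v) = pairL n Ω u v * a := by
  rw [← pairing_eq_pairL, ← pairing_eq_pairL, pairing, pairing]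
  rw [show (∫ x in Ω, star (u x) * v x) * a = (mulCLM n).flip a (∫ x in Ω, star (u x) * v x)
    from rfl, ← ContinuousLinearMap.integral_comp_comm _ (integrable_star_mul u v)]
  refine integral_congr_ae ?_
  filter_upwards [coeFn_rightMul a v] with x hx
  simp [hx, mul_assoc]

/-- Right multiplication by `a ∈ ℝ_n` on pairs `(F, (∂_i F)_i)`. -/
def Jet.rightMul {n : ℕ} {Ω : Set (E n)} (a : Cl n) (p : Jet n Ω) : Jet n Ω :=
  WithLp.toLp 2 (SphericalDirac.rightMul Ω a p.fn,
    WithLp.toLp 2 fun i => SphericalDirac.rightMul Ω a (p.grad i))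

/-- The function of a pair, as a continuous linear map. -/
def fnL (n : ℕ) (Ω : Set (E n)) : Jet n Ω →L[ℝ] L2 n Ω := WithLp.fstL 2 ℝ _ _

/-- The `i`-th derivative of a pair, as a continuous linear map. -/
def gradL {n : ℕ} (Ω : Set (E n)) (i : Fin n) : Jet n Ω →L[ℝ] L2 n Ω :=
  PiLp.proj 2 (fun _ : Fin n => L2 n Ω) i ∘L WithLp.sndL 2 ℝ _ _

@[simp] theorem fnL_apply {n : ℕ} {Ω : Set (E n)} (p : Jet n Ω) : fnL n Ω p = p.fn := rfl

@[simp] theorem gradL_apply {n : ℕ} {Ω : Set (E n)} (p : Jet n Ω) (i : Fin n) :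
    gradL Ω i p = p.grad i := rfl

theorem Jet.norm_sq {n : ℕ} {Ω : Set (E n)} (p : Jet n Ω) :
    ‖p‖ ^ 2 = ‖p.fn‖ ^ 2 + ∑ i, ‖p.grad i‖ ^ 2 := by
  rw [WithLp.prod_norm_sq_eq_of_L2, PiLp.norm_sq_eq_of_L2]
  rfl

theorem Jet.continuous_rightMul {n : ℕ} {Ω : Set (E n)} (a : Cl n) :
    Continuous (Jet.rightMul (Ω := Ω) a) := by
  refine (WithLp.prod_continuous_toLp 2 _ _).comp (Continuous.prodMk ?_ ?_)
  · exact ((SphericalDirac.rightMul Ω a).comp (fnL n Ω)).continuous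
  · refine (PiLp.continuous_toLp 2 _).comp (continuous_pi fun i => ?_)
    exact ((SphericalDirac.rightMul Ω a).comp (gradL Ω i)).continuous

theorem integral_smul_rightMul {n : ℕ} {Ω : Set (E n)} {φ : E n → ℝ}
    (h : MemLp φ 2 (volume.restrict Ω)) (a : Cl n) (u : L2 n Ω) :
    ∫ x in Ω, φ x • rightMul Ω a u x = (∫ x in Ω, φ x • u x) * a := by
  rw [show (∫ x in Ω, φ x • u x) * a = (mulCLM n).flip a (∫ x in Ω, φ x • u x) from rfl,
    ← ContinuousLinearMap.integral_comp_comm _ (integrable_smul_L2 h u)]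
  refine integral_congr_ae ?_
  filter_upwards [coeFn_rightMul a u] with x hx
  simp [hx]

/-- Right multiplication by `a ∈ ℝ_n` on `H¹(Ω, ℝ_n)`. -/
def H1.rightMul {n : ℕ} {Ω : Set (E n)} (a : Cl n) (p : H1 n Ω) : H1 n Ω :=
  ⟨Jet.rightMul a p, fun i φ hφ => by
    have := p.2 i φ hφ
    change ∫ x in Ω, partialDeriv i φ x • SphericalDirac.rightMul Ω a (p : Jet n Ω).fn x =
      -∫ x in Ω, φ x • SphericalDirac.rightMul Ω a ((p : Jet n Ω).grad i) x
    rw [integral_smul_rightMul hφ.memLp, integral_smul_rightMul (hφ.memLp_partialDeriv i), this,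
      neg_mul]⟩

theorem H1.rightMul_mem_testSubspace {n : ℕ} {Ω : Set (E n)} (a : Cl n) {p : H1 n Ω}
    (hp : p ∈ testSubspace n Ω) : H1.rightMul a p ∈ testSubspace n Ω := by
  obtain ⟨φ, hφ, h1, h2⟩ := hp
  refine ⟨fun x => (mulCLM n).flip a (φ x), ⟨?_, ?_, ?_⟩, ?_, fun i => ?_⟩
  · exact ((mulCLM n).flip a).contDiff.comp hφ.contDiff
  · exact hφ.hasCompactSupport.comp_left (g := (mulCLM n).flip a) (map_zero _)
  · exact (tsupport_comp_subset (g := (mulCLM n).flip a) (map_zero _) φ).trans hφ.tsupport_subset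
  · refine (coeFn_rightMul a _).trans ?_
    filter_upwards [h1] with x hx
    simp [hx]
  · refine (coeFn_rightMul a _).trans ?_
    filter_upwards [h2 i] with x hx
    rw [hx, partialDeriv, partialDeriv]
    have := ((mulCLM n).flip a).hasFDerivAt.comp x
      (hφ.contDiff.differentiable (by simp) x).hasFDerivAt
    rw [show (fun x => (mulCLM n).flip a (φ x)) = (mulCLM n).flip a ∘ φ from rfl, this.fderiv]
    rfl

/-- Right multiplication by `a ∈ ℝ_n` on `H¹_0(Ω, ℝ_n)`. -/
def H10.rightMul {n : ℕ} {Ω : Set (E n)} (a : Cl n) (p : H10 n Ω) : H10 n Ω :=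
  -- A continuous map preserving the test functions preserves their closure.
  ⟨H1.rightMul a p, map_mem_closure
    (((Jet.continuous_rightMul a).comp continuous_subtype_val).subtype_mk _) p.2
    fun _ => H1.rightMul_mem_testSubspace a⟩

/-! ### Closedness -/

theorem continuous_integral_smul {n : ℕ} {Ω : Set (E n)} {φ : E n → ℝ}
    (h : MemLp φ 2 (volume.restrict Ω)) :
    Continuous fun u : L2 n Ω => ∫ x in Ω, φ x • u x := by
  have h1 : (fun u : L2 n Ω => ∫ x in Ω, φ x • u x) =
      (ContinuousLinearMap.lsmul ℝ ℝ : ℝ →L[ℝ] Cl n →L[ℝ] Cl n).lpPairing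
        (volume.restrict Ω) 2 2 (h.toLp φ) := by
    funext u
    rw [ContinuousLinearMap.lpPairing_eq_integral]
    refine integral_congr_ae ?_
    filter_upwards [h.coeFn_toLp] with x hx
    simp [hx]
  rw [h1]
  exact ContinuousLinearMap.continuous _

/-- Each test function imposes a closed condition, both sides being continuous in the pair.
Closedness supplies the completeness needed for Lax–Milgram. -/
theorem isClosed_H1 (n : ℕ) (Ω : Set (E n)) : IsClosed (H1 n Ω : Set (Jet n Ω)) := by
  have h : (H1 n Ω : Set (Jet n Ω)) = ⋂ i : Fin n, ⋂ φ : E n → ℝ, ⋂ _ : IsTestFunction Ω φ,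
      {p : Jet n Ω | ∫ x in Ω, partialDeriv i φ x • p.fn x = -∫ x in Ω, φ x • p.grad i x} := by
    ext p
    simp only [Set.mem_iInter]
    rfl
  rw [h]
  refine isClosed_iInter fun i => isClosed_iInter fun φ => isClosed_iInter fun hφ => ?_
  exact isClosed_eq
    ((continuous_integral_smul (hφ.memLp_partialDeriv i)).comp (fnL n Ω).continuous)
    ((continuous_integral_smul hφ.memLp).comp (gradL Ω i).continuous).neg

/-- `H¹_0(Ω, ℝ_n)` as a subspace of the space of pairs `(F, (∂_i F)_i)`. -/
def jetH10 (n : ℕ) (Ω : Set (E n)) : Submodule ℝ (Jet n Ω) :=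
  (H10 n Ω).map (H1 n Ω).subtype

theorem coe_mem_jetH10 {n : ℕ} {Ω : Set (E n)} (F : H10 n Ω) :
    ((F : H1 n Ω) : Jet n Ω) ∈ jetH10 n Ω :=
  ⟨F, F.2, rfl⟩

theorem isClosed_jetH10 (n : ℕ) (Ω : Set (E n)) : IsClosed (jetH10 n Ω : Set (Jet n Ω)) :=
  (isClosed_H1 n Ω).isClosedEmbedding_subtypeVal.isClosedMap _
    (Submodule.isClosed_topologicalClosure (testSubspace n Ω))

/-! ### Multiplication operators -/

/-- Continuous coefficients are bounded on the compact closure of `Ω`; this makes the form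
continuous. -/
theorem memLp_top_of_isBounded {n : ℕ} {Ω : Set (E n)} (hΩ : IsOpen Ω)
    (hbdd : Bornology.IsBounded Ω) {c : E n → Cl n} (hc : Continuous c) :
    MemLp c ⊤ (volume.restrict Ω) := by
  obtain ⟨C, hC⟩ := hbdd.isCompact_closure.exists_bound_of_continuousOn hc.continuousOn
  refine memLp_top_of_bound hc.aestronglyMeasurable C ?_
  exact (ae_restrict_mem hΩ.measurableSet).mono fun x hx => hC x (subset_closure hx)

/-- Left multiplication by a bounded function on `L²(Ω, ℝ_n)`. -/
def leftMul {n : ℕ} {Ω : Set (E n)} {c : E n → Cl n} (hc : MemLp c ⊤ (volume.restrict Ω)) :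
    L2 n Ω →L[ℝ] L2 n Ω :=
  (mulCLM n).holderL (volume.restrict Ω) ⊤ 2 2 (hc.toLp c)

theorem coeFn_sum_L2 {n : ℕ} {Ω : Set (E n)} {ι : Type*} (t : Finset ι) (u : ι → L2 n Ω) :
    (∑ i ∈ t, u i : L2 n Ω) =ᵐ[volume.restrict Ω] fun x => ∑ i ∈ t, u i x := by
  classical
  induction t using Finset.induction_on with
  | empty => exact Lp.coeFn_zero _ _ _
  | insert i t hi ih =>
    rw [Finset.sum_insert hi]
    filter_upwards [Lp.coeFn_add (u i) (∑ j ∈ t, u j), ih] with x h1 h2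
    rw [h1, Pi.add_apply, h2, Finset.sum_insert hi]

theorem coeFn_leftMul {n : ℕ} {Ω : Set (E n)} {c : E n → Cl n}
    (hc : MemLp c ⊤ (volume.restrict Ω)) (u : L2 n Ω) :
    leftMul hc u =ᵐ[volume.restrict Ω] fun x => c x * u x := by
  refine ((mulCLM n).coeFn_holder _ _).trans ?_
  filter_upwards [hc.coeFn_toLp] with x hx
  simp [hx]

/-- The first order operator `∑ i, c_i ∂_{x_i} + c₀` with bounded coefficients. -/
def firstOrder {n : ℕ} {Ω : Set (E n)} {c : Fin n → E n → Cl n} {c₀ : E n → Cl n}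
    (hc : ∀ i, MemLp (c i) ⊤ (volume.restrict Ω)) (hc₀ : MemLp c₀ ⊤ (volume.restrict Ω)) :
    Jet n Ω →L[ℝ] L2 n Ω :=
  ∑ i, leftMul (hc i) ∘L gradL Ω i + leftMul hc₀ ∘L fnL n Ω

theorem coeFn_firstOrder {n : ℕ} {Ω : Set (E n)} {c : Fin n → E n → Cl n} {c₀ : E n → Cl n}
    (hc : ∀ i, MemLp (c i) ⊤ (volume.restrict Ω)) (hc₀ : MemLp c₀ ⊤ (volume.restrict Ω))
    (p : Jet n Ω) : firstOrder hc hc₀ p =ᵐ[volume.restrict Ω]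
      fun x => ∑ i, c i x * p.grad i x + c₀ x * p.fn x := by
  have h1 : firstOrder hc hc₀ p = ∑ i, leftMul (hc i) (p.grad i) + leftMul hc₀ p.fn := by
    simp [firstOrder]
  rw [h1]
  refine (Lp.coeFn_add _ _).trans ?_
  filter_upwards [coeFn_sum_L2 Finset.univ fun i => leftMul (hc i) (p.grad i),
    coeFn_leftMul hc₀ p.fn, ae_all_iff.2 fun i => coeFn_leftMul (hc i) (p.grad i)] with x h2 h3 h4
  rw [Pi.add_apply, h2, h3]
  simp [h4]

/-! ### The sesquilinear form as a continuous bilinear form -/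

section Form

variable {n : ℕ} {Ω : Set (E n)}

/-- The operator `(1 + |x|²) E`. -/
def eulerL (hΩ : IsOpen Ω) (hbdd : Bornology.IsBounded Ω) : Jet n Ω →L[ℝ] L2 n Ω :=
  firstOrder (c := fun i x => ((1 + ‖x‖ ^ 2) * x i) • 1) (c₀ := fun _ => 0)
    (fun _ => memLp_top_of_isBounded hΩ hbdd (by fun_prop))
    (memLp_top_of_isBounded hΩ hbdd (by fun_prop))

/-- The operator `(1 + |x|²) x D_e`. -/
def vecDiracL (hΩ : IsOpen Ω) (hbdd : Bornology.IsBounded Ω) : Jet n Ω →L[ℝ] L2 n Ω :=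
  firstOrder (c := fun i x => (1 + ‖x‖ ^ 2) • (vec x * unit i)) (c₀ := fun _ => 0)
    (fun _ => memLp_top_of_isBounded hΩ hbdd
      (by have := continuous_vec (n := n); fun_prop))
    (memLp_top_of_isBounded hΩ hbdd (by fun_prop))

/-- The operator `D_S`. -/
def sphDiracL (hΩ : IsOpen Ω) (hbdd : Bornology.IsBounded Ω) : Jet n Ω →L[ℝ] L2 n Ω :=
  firstOrder (c := fun i x => (1 + ‖x‖ ^ 2) • unit i) (c₀ := fun x => -((n : ℝ) • vec x))
    (fun _ => memLp_top_of_isBounded hΩ hbdd (by fun_prop))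
    (memLp_top_of_isBounded hΩ hbdd (by have := continuous_vec (n := n); fun_prop))

/-- Multiplication by `(1 + |x|²)²`. -/
def weightL (hΩ : IsOpen Ω) (hbdd : Bornology.IsBounded Ω) : L2 n Ω →L[ℝ] L2 n Ω :=
  leftMul (c := fun x => ((1 + ‖x‖ ^ 2) ^ 2) • 1) (memLp_top_of_isBounded hΩ hbdd (by fun_prop))

/-- The part of order at most one of `Q_s(D_S)`. -/
def lowerOrder (hΩ : IsOpen Ω) (hbdd : Bornology.IsBounded Ω)
    (s : EuclideanSpace ℝ (Fin (n + 1))) : Jet n Ω →L[ℝ] L2 n Ω :=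
  (2 * (2 + n) : ℝ) • eulerL hΩ hbdd + (2 : ℝ) • vecDiracL hΩ hbdd
    - (2 * s 0) • sphDiracL hΩ hbdd + (‖s‖ ^ 2 + n ^ 2) • fnL n Ω

theorem coeFn_eulerL (hΩ : IsOpen Ω) (hbdd : Bornology.IsBounded Ω) (p : Jet n Ω) :
    eulerL hΩ hbdd p =ᵐ[volume.restrict Ω]
      fun x => (1 + ‖x‖ ^ 2) • ∑ i, x i • p.grad i x := by
  filter_upwards [coeFn_firstOrder (c := fun i x => ((1 + ‖x‖ ^ 2) * x i) • 1) (c₀ := fun _ => 0)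
    (fun _ => memLp_top_of_isBounded hΩ hbdd (by fun_prop))
    (memLp_top_of_isBounded hΩ hbdd (by fun_prop)) p] with x hx
  refine hx.trans ?_
  simp [Finset.smul_sum, smul_smul]

theorem coeFn_vecDiracL (hΩ : IsOpen Ω) (hbdd : Bornology.IsBounded Ω) (p : Jet n Ω) :
    vecDiracL hΩ hbdd p =ᵐ[volume.restrict Ω]
      fun x => (1 + ‖x‖ ^ 2) • (vec x * ∑ i, unit i * p.grad i x) := by
  filter_upwards [coeFn_firstOrder (c := fun i x => (1 + ‖x‖ ^ 2) • (vec x * unit i))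
    (c₀ := fun _ => 0)
    (fun _ => memLp_top_of_isBounded hΩ hbdd
      (by have := continuous_vec (n := n); fun_prop))
    (memLp_top_of_isBounded hΩ hbdd (by fun_prop)) p] with x hx
  refine hx.trans ?_
  simp [Finset.smul_sum, Finset.mul_sum, mul_assoc]

theorem coeFn_sphDiracL (hΩ : IsOpen Ω) (hbdd : Bornology.IsBounded Ω) (p : Jet n Ω) :
    sphDiracL hΩ hbdd p =ᵐ[volume.restrict Ω] fun x =>
      (1 + ‖x‖ ^ 2) • (∑ i, unit i * p.grad i x) - (n : ℝ) • (vec x * p.fn x) := by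
  filter_upwards [coeFn_firstOrder (c := fun i x => (1 + ‖x‖ ^ 2) • unit i)
    (c₀ := fun x => -((n : ℝ) • vec x))
    (fun _ => memLp_top_of_isBounded hΩ hbdd (by fun_prop))
    (memLp_top_of_isBounded hΩ hbdd (by have := continuous_vec (n := n); fun_prop)) p] with x hx
  refine hx.trans ?_
  simp only [Finset.smul_sum, smul_mul_assoc, neg_mul, sub_eq_add_neg]

theorem coeFn_weightL (hΩ : IsOpen Ω) (hbdd : Bornology.IsBounded Ω) (u : L2 n Ω) :
    weightL hΩ hbdd u =ᵐ[volume.restrict Ω] fun x => ((1 + ‖x‖ ^ 2) ^ 2) • u x := by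
  filter_upwards [coeFn_leftMul (c := fun x => ((1 + ‖x‖ ^ 2) ^ 2) • 1)
    (memLp_top_of_isBounded hΩ hbdd (by fun_prop)) u] with x hx
  refine hx.trans ?_
  simp

theorem coeFn_lowerOrder (hΩ : IsOpen Ω) (hbdd : Bornology.IsBounded Ω)
    (s : EuclideanSpace ℝ (Fin (n + 1))) (p : Jet n Ω) :
    lowerOrder hΩ hbdd s p =ᵐ[volume.restrict Ω] fun x =>
      (2 * (2 + n) : ℝ) • (1 + ‖x‖ ^ 2) • (∑ i, x i • p.grad i x)
      + (2 : ℝ) • (1 + ‖x‖ ^ 2) • (vec x * ∑ i, unit i * p.grad i x)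
      - (2 * s 0) • ((1 + ‖x‖ ^ 2) • (∑ i, unit i * p.grad i x) - (n : ℝ) • (vec x * p.fn x))
      + (‖s‖ ^ 2 + n ^ 2) • p.fn x := by
  have h : lowerOrder hΩ hbdd s p = (2 * (2 + n) : ℝ) • eulerL hΩ hbdd p
      + (2 : ℝ) • vecDiracL hΩ hbdd p - (2 * s 0) • sphDiracL hΩ hbdd p
      + (‖s‖ ^ 2 + n ^ 2) • p.fn := by
    simp [lowerOrder]
  rw [h]
  filter_upwards [coeFn_eulerL hΩ hbdd p, coeFn_vecDiracL hΩ hbdd p, coeFn_sphDiracL hΩ hbdd p,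
    Lp.coeFn_add ((2 * (2 + n) : ℝ) • eulerL hΩ hbdd p + (2 : ℝ) • vecDiracL hΩ hbdd p
      - (2 * s 0) • sphDiracL hΩ hbdd p) ((‖s‖ ^ 2 + n ^ 2) • p.fn),
    Lp.coeFn_sub ((2 * (2 + n) : ℝ) • eulerL hΩ hbdd p + (2 : ℝ) • vecDiracL hΩ hbdd p)
      ((2 * s 0) • sphDiracL hΩ hbdd p),
    Lp.coeFn_add ((2 * (2 + n) : ℝ) • eulerL hΩ hbdd p) ((2 : ℝ) • vecDiracL hΩ hbdd p),
    Lp.coeFn_smul (2 * (2 + n) : ℝ) (eulerL hΩ hbdd p),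
    Lp.coeFn_smul (2 : ℝ) (vecDiracL hΩ hbdd p),
    Lp.coeFn_smul (2 * s 0) (sphDiracL hΩ hbdd p),
    Lp.coeFn_smul (‖s‖ ^ 2 + n ^ 2 : ℝ) p.fn] with x h1 h2 h3 h4 h5 h6 h7 h8 h9 h10
  rw [h4, Pi.add_apply, h5, Pi.sub_apply, h6, Pi.add_apply, h7, h8, h9, h10]
  simp only [Pi.smul_apply]
  rw [h1, h2, h3]

/-- The scalar part of `q_s` as a continuous bilinear form. -/
def scalarForm (hΩ : IsOpen Ω) (hbdd : Bornology.IsBounded Ω)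
    (s : EuclideanSpace ℝ (Fin (n + 1))) : Jet n Ω →L[ℝ] Jet n Ω →L[ℝ] ℝ :=
  ∑ i, (innerSL ℝ (E := L2 n Ω)).bilinearComp (weightL hΩ hbdd ∘L gradL Ω i) (gradL Ω i)
    + (innerSL ℝ (E := L2 n Ω)).bilinearComp (lowerOrder hΩ hbdd s) (fnL n Ω)

theorem scalarForm_apply (hΩ : IsOpen Ω) (hbdd : Bornology.IsBounded Ω)
    (s : EuclideanSpace ℝ (Fin (n + 1))) (p q : Jet n Ω) :
    scalarForm hΩ hbdd s p q =
      ∑ i, ⟪weightL hΩ hbdd (p.grad i), q.grad i⟫_ℝ + ⟪lowerOrder hΩ hbdd s p, q.fn⟫_ℝ := by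
  simp [scalarForm]

/-- Collecting all terms paired with `G` itself into one bounded operator makes continuity and right
linearity immediate. -/
theorem qForm_eq (hΩ : IsOpen Ω) (hbdd : Bornology.IsBounded Ω)
    (s : EuclideanSpace ℝ (Fin (n + 1))) (F G : H1 n Ω) :
    qForm s F G = ∑ i, pairL n Ω (weightL hΩ hbdd ((F : Jet n Ω).grad i)) ((G : Jet n Ω).grad i)
      + pairL n Ω (lowerOrder hΩ hbdd s F) (G : Jet n Ω).fn := by
  rw [qForm]
  have h1 : ∀ i, pairing Ω (fun x => (1 + ‖x‖ ^ 2) ^ 2 • (F : Jet n Ω).grad i x)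
      ((G : Jet n Ω).grad i) =
      pairL n Ω (weightL hΩ hbdd ((F : Jet n Ω).grad i)) ((G : Jet n Ω).grad i) := fun i => by
    rw [← pairing_eq_pairL]
    exact (pairing_congr_left _ (coeFn_weightL hΩ hbdd _)).symm
  have h2 : pairing Ω (fun x => (1 + ‖x‖ ^ 2) • euler F x) (G : Jet n Ω).fn =
      pairL n Ω (eulerL hΩ hbdd F) (G : Jet n Ω).fn := by
    rw [← pairing_eq_pairL]
    exact (pairing_congr_left _ (coeFn_eulerL hΩ hbdd _)).symm
  have h3 : pairing Ω (fun x => (1 + ‖x‖ ^ 2) • (vec x * eucDirac F x)) (G : Jet n Ω).fn =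
      pairL n Ω (vecDiracL hΩ hbdd F) (G : Jet n Ω).fn := by
    rw [← pairing_eq_pairL]
    exact (pairing_congr_left _ (coeFn_vecDiracL hΩ hbdd _)).symm
  have h4 : pairing Ω (sphDirac F) (G : Jet n Ω).fn =
      pairL n Ω (sphDiracL hΩ hbdd F) (G : Jet n Ω).fn := by
    rw [← pairing_eq_pairL]
    exact (pairing_congr_left _ (coeFn_sphDiracL hΩ hbdd _)).symm
  simp only [h1, h2, h3, h4, pairing_eq_pairL, lowerOrder]
  simp [add_assoc, add_sub_assoc]

theorem inner_one_qForm (hΩ : IsOpen Ω) (hbdd : Bornology.IsBounded Ω)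
    (s : EuclideanSpace ℝ (Fin (n + 1))) (F G : H1 n Ω) :
    ⟪(1 : Cl n), qForm s F G⟫_ℝ = scalarForm hΩ hbdd s F G := by
  rw [qForm_eq hΩ hbdd, scalarForm_apply, inner_add_right, inner_sum]
  simp only [inner_one_pairL]

theorem qForm_rightMul (hΩ : IsOpen Ω) (hbdd : Bornology.IsBounded Ω)
    (s : EuclideanSpace ℝ (Fin (n + 1))) (F G : H1 n Ω) (a : Cl n) :
    qForm s F (H1.rightMul a G) = qForm s F G * a := by
  rw [qForm_eq hΩ hbdd, qForm_eq hΩ hbdd, add_mul, Finset.sum_mul, ← pairL_rightMul]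
  simp only [← pairL_rightMul]
  rfl

end Form

/-! ### Coercivity -/

/-- The smaller eigenvalue of the symmetric matrix `!![a, -c; -c, b]` is a lower bound of its
quadratic form. -/
theorem min_eigenvalue_mul_le (a b c f g : ℝ) :
    (1 / 2 * (a + b) - 1 / 2 * √((a - b) ^ 2 + 4 * c ^ 2)) * (f ^ 2 + g ^ 2) ≤
      a * f ^ 2 + b * g ^ 2 - 2 * c * f * g := by
  set R := √((a - b) ^ 2 + 4 * c ^ 2) with hR
  have hR2 : R ^ 2 = (a - b) ^ 2 + 4 * c ^ 2 := Real.sq_sqrt (by positivity)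
  have hab : |a - b| ≤ R := Real.abs_le_sqrt (by nlinarith [sq_nonneg c])
  obtain ⟨h1, h2⟩ := abs_le.1 hab
  have h3 : 0 ≤ (R + (a - b)) * f ^ 2 := mul_nonneg (by linarith) (sq_nonneg f)
  have h4 : 0 ≤ (R - (a - b)) * g ^ 2 := mul_nonneg (by linarith) (sq_nonneg g)
  -- AM–GM: the two coefficients on the right are nonnegative with product `4 c²`.
  have h5 : 4 * c * f * g ≤ (R + (a - b)) * f ^ 2 + (R - (a - b)) * g ^ 2 := by
    refine le_of_sq_le_sq ?_ (add_nonneg h3 h4)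
    have h6 : (R + (a - b)) * (R - (a - b)) = 4 * c ^ 2 := by linear_combination hR2
    have h7 : (4 * c * f * g) ^ 2 =
        4 * (((R + (a - b)) * f ^ 2) * ((R - (a - b)) * g ^ 2)) := by
      linear_combination -4 * f ^ 2 * g ^ 2 * h6
    rw [h7]
    nlinarith [sq_nonneg ((R + (a - b)) * f ^ 2 - (R - (a - b)) * g ^ 2)]
  linarith

/-- `(a + b)² - ((a - b)² + 4c²) = 4(ab - c²)`: positive trace and determinant make the smaller
eigenvalue positive. -/
theorem min_eigenvalue_pos {a b c : ℝ} (h1 : 0 < a + b) (h2 : c ^ 2 < a * b) :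
    0 < 1 / 2 * (a + b) - 1 / 2 * √((a - b) ^ 2 + 4 * c ^ 2) := by
  have : √((a - b) ^ 2 + 4 * c ^ 2) < a + b :=
    (Real.sqrt_lt' h1).2 (by nlinarith)
  linarith

theorem norm_sum_smul_le {n : ℕ} (x : E n) (g : Fin n → Cl n) :
    ‖∑ i, x i • g i‖ ≤ ‖x‖ * √(∑ i, ‖g i‖ ^ 2) := by
  calc ‖∑ i, x i • g i‖ ≤ ∑ i, ‖x i‖ * ‖g i‖ :=
        (norm_sum_le _ _).trans (Finset.sum_le_sum fun i _ => (norm_smul _ _).le)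
    _ ≤ √(∑ i, ‖x i‖ ^ 2) * √(∑ i, ‖g i‖ ^ 2) := Real.sum_mul_le_sqrt_mul_sqrt _ _ _
    _ = _ := by rw [EuclideanSpace.norm_eq]

/-- Cauchy–Schwarz against the constant vector `1`; this is the source of the factor `√n` in `H`. -/
theorem norm_sum_unit_mul_le {n : ℕ} (g : Fin n → Cl n) :
    ‖∑ i, unit i * g i‖ ≤ √n * √(∑ i, ‖g i‖ ^ 2) := by
  calc ‖∑ i, unit i * g i‖ ≤ ∑ i, 1 * ‖g i‖ :=
        (norm_sum_le _ _).trans (Finset.sum_le_sum fun i _ => by rw [norm_unit_mul, one_mul])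
    _ ≤ √(∑ _i : Fin n, 1 ^ 2) * √(∑ i, ‖g i‖ ^ 2) := Real.sum_mul_le_sqrt_mul_sqrt _ _ _
    _ = _ := by simp

theorem inner_vec_mul_self {n : ℕ} (x : E n) (a : Cl n) : ⟪vec x * a, a⟫_ℝ = 0 := by
  have := inner_vec_mul_left x a a
  rw [real_inner_comm (vec x * a) a] at this
  linarith

/-- Half of the first order contribution. Here `t` stands for `√n`, `r` for `|x|`, `σ` for `s₀`, `φ`
and `γ` for the sizes of `F` and its gradient, and `S`, `V`, `D` for the inner products of `E F`, `x
D_e F`, `D_e F` with `F`. The bound on `S` has no factor `t`; inserting one by `1 ≤ t` merges the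
coefficients `2 + n` and `1` into `3 + n`. -/
theorem cross_terms_le {n t r M σ φ γ S V D : ℝ} (hn : 0 ≤ n) (ht : 1 ≤ t) (hr : 0 ≤ r)
    (hrM : r ≤ M) (hφ : 0 ≤ φ) (hγ : 0 ≤ γ) (hS : |S| ≤ r * γ * φ) (hV : |V| ≤ r * (t * γ) * φ)
    (hD : |D| ≤ t * γ * φ) :
    -(t * (1 + M ^ 2) * ((3 + n) * M + |σ|) * φ * γ) ≤
      (1 + r ^ 2) * ((2 + n) * S + V - σ * D) := by
  have hM : 0 ≤ M := hr.trans hrM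
  have hφγ : 0 ≤ φ * γ := mul_nonneg hφ hγ
  have hσD : σ * D ≤ |σ| * (t * γ * φ) :=
    (le_abs_self _).trans (by rw [abs_mul]; exact mul_le_mul_of_nonneg_left hD (abs_nonneg _))
  have h1 : -(t * ((3 + n) * M + |σ|) * (φ * γ)) ≤ (2 + n) * S + V - σ * D := by
    have h2 : (2 + n) * -(r * γ * φ) ≤ (2 + n) * S :=
      mul_le_mul_of_nonneg_left (abs_le.1 hS).1 (by linarith)
    have h3 := (abs_le.1 hV).1
    have h4 : (2 + n) * r + r * t ≤ t * ((3 + n) * M) := by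
      have h5 : (2 + n) * r ≤ (2 + n) * M := mul_le_mul_of_nonneg_left hrM (by linarith)
      have h6 : (2 + n) * M ≤ t * ((2 + n) * M) :=
        le_mul_of_one_le_left (mul_nonneg (by linarith) hM) ht
      have h7 : r * t ≤ M * t := mul_le_mul_of_nonneg_right hrM (by linarith)
      linarith
    have h8 := mul_le_mul_of_nonneg_right h4 hφγ
    linarith
  have h9 : 0 ≤ t * ((3 + n) * M + |σ|) * (φ * γ) := by positivity
  have h10 : 1 + r ^ 2 ≤ 1 + M ^ 2 := by gcongr
  calc _ = -((1 + M ^ 2) * (t * ((3 + n) * M + |σ|) * (φ * γ))) := by ring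
    _ ≤ -((1 + r ^ 2) * (t * ((3 + n) * M + |σ|) * (φ * γ))) :=
        neg_le_neg (mul_le_mul_of_nonneg_right h10 h9)
    _ = (1 + r ^ 2) * -(t * ((3 + n) * M + |σ|) * (φ * γ)) := by ring
    _ ≤ _ := mul_le_mul_of_nonneg_left h1 (by positivity)

theorem constH_mul_le_pointwise {n : ℕ} (hn : 1 ≤ n) {m M : ℝ} (hm : 0 ≤ m) {x : E n}
    (hmx : m ≤ ‖x‖) (hxM : ‖x‖ ≤ M) (s : EuclideanSpace ℝ (Fin (n + 1)))
    (f : Cl n) (g : Fin n → Cl n) :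
    constH n m M s * (‖f‖ ^ 2 + ∑ i, ‖g i‖ ^ 2) ≤
      ∑ i, ⟪((1 + ‖x‖ ^ 2) ^ 2) • g i, g i⟫_ℝ +
      ⟪(2 * (2 + n) : ℝ) • (1 + ‖x‖ ^ 2) • (∑ i, x i • g i)
      + (2 : ℝ) • (1 + ‖x‖ ^ 2) • (vec x * ∑ i, unit i * g i)
      - (2 * s 0) • ((1 + ‖x‖ ^ 2) • (∑ i, unit i * g i) - (n : ℝ) • (vec x * f))
      + (‖s‖ ^ 2 + n ^ 2) • f, f⟫_ℝ := by
  have hS : |⟪∑ i, x i • g i, f⟫_ℝ| ≤ ‖x‖ * √(∑ i, ‖g i‖ ^ 2) * ‖f‖ :=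
    (abs_real_inner_le_norm _ _).trans
      (mul_le_mul_of_nonneg_right (norm_sum_smul_le x g) (norm_nonneg f))
  have hD : |⟪∑ i, unit i * g i, f⟫_ℝ| ≤ √n * √(∑ i, ‖g i‖ ^ 2) * ‖f‖ :=
    (abs_real_inner_le_norm _ _).trans
      (mul_le_mul_of_nonneg_right (norm_sum_unit_mul_le g) (norm_nonneg f))
  have hV : |⟪vec x * ∑ i, unit i * g i, f⟫_ℝ| ≤ ‖x‖ * (√n * √(∑ i, ‖g i‖ ^ 2)) * ‖f‖ :=
    (abs_real_inner_le_norm _ _).trans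
      (mul_le_mul_of_nonneg_right ((norm_vec_mul x _).le.trans
        (mul_le_mul_of_nonneg_left (norm_sum_unit_mul_le g) (norm_nonneg x))) (norm_nonneg f))
  have hfirst : ∑ i, ⟪((1 + ‖x‖ ^ 2) ^ 2) • g i, g i⟫_ℝ =
      (1 + ‖x‖ ^ 2) ^ 2 * ∑ i, ‖g i‖ ^ 2 := by
    rw [Finset.mul_sum]
    exact Finset.sum_congr rfl fun i _ => by
      rw [real_inner_smul_left, real_inner_self_eq_norm_sq]
  have hγ2 : √(∑ i, ‖g i‖ ^ 2) ^ 2 = ∑ i, ‖g i‖ ^ 2 :=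
    Real.sq_sqrt (Finset.sum_nonneg fun i _ => sq_nonneg _)
  have hn1 : (1 : ℝ) ≤ √n := Real.one_le_sqrt.2 (by exact_mod_cast hn)
  rw [hfirst, ← hγ2]
  simp only [inner_add_left, inner_sub_left, real_inner_smul_left, inner_vec_mul_self,
    real_inner_self_eq_norm_sq]
  have hcross := cross_terms_le (σ := s 0) (Nat.cast_nonneg n) hn1 (norm_nonneg x) hxM
    (norm_nonneg f) (Real.sqrt_nonneg _) hS hV hD
  have hmin := min_eigenvalue_mul_le (‖s‖ ^ 2 + n ^ 2 - 2 * |s 0| * n * M) ((1 + m ^ 2) ^ 2)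
    (√n * (1 + M ^ 2) * ((3 + n) * M + |s 0|)) ‖f‖ √(∑ i, ‖g i‖ ^ 2)
  rw [show 1 / 2 * (‖s‖ ^ 2 + n ^ 2 - 2 * |s 0| * n * M + (1 + m ^ 2) ^ 2) -
    1 / 2 * √((‖s‖ ^ 2 + n ^ 2 - 2 * |s 0| * n * M - (1 + m ^ 2) ^ 2) ^ 2 +
      4 * (√n * (1 + M ^ 2) * ((3 + n) * M + |s 0|)) ^ 2) = constH n m M s from rfl] at hmin
  refine hmin.trans ?_
  have hM0 : 0 ≤ M := (norm_nonneg x).trans hxM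
  have hb : (1 + m ^ 2) ^ 2 * √(∑ i, ‖g i‖ ^ 2) ^ 2 ≤
      (1 + ‖x‖ ^ 2) ^ 2 * √(∑ i, ‖g i‖ ^ 2) ^ 2 := by gcongr
  -- The term `x F` contributes nothing, so the summand `-2|s₀|nM` of `a` is simply given away.
  have ha : 0 ≤ |s 0| * n * M * ‖f‖ ^ 2 := by positivity
  generalize √(∑ i, ‖g i‖ ^ 2) = γ at *
  generalize ⟪∑ i, x i • g i, f⟫_ℝ = S at *
  generalize ⟪vec x * ∑ i, unit i * g i, f⟫_ℝ = V at *
  generalize ⟪∑ i, unit i * g i, f⟫_ℝ = D at *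
  linarith

theorem integral_norm_sq_L2 {n : ℕ} {Ω : Set (E n)} (u : L2 n Ω) :
    ∫ x in Ω, ‖u x‖ ^ 2 = ‖u‖ ^ 2 := by
  rw [← real_inner_self_eq_norm_sq, L2.inner_def]
  simp only [real_inner_self_eq_norm_sq]

theorem integrable_norm_sq_L2 {n : ℕ} {Ω : Set (E n)} (u : L2 n Ω) :
    Integrable (fun x => ‖u x‖ ^ 2) (volume.restrict Ω) := by
  simpa only [real_inner_self_eq_norm_sq] using L2.integrable_inner (𝕜 := ℝ) u u

/-- The pointwise bound integrated over `Ω`. No integration by parts enters, so it holds for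
arbitrary pairs. -/
theorem constH_mul_norm_sq_le {n : ℕ} (hn : 1 ≤ n) {Ω : Set (E n)} (hΩ : IsOpen Ω)
    (hbdd : Bornology.IsBounded Ω) {m M : ℝ} (hm0 : 0 ≤ m) (hm : ∀ x ∈ Ω, m ≤ ‖x‖)
    (hM : ∀ x ∈ Ω, ‖x‖ ≤ M) (s : EuclideanSpace ℝ (Fin (n + 1))) (p : Jet n Ω) :
    constH n m M s * ‖p‖ ^ 2 ≤ scalarForm hΩ hbdd s p p := by
  have h1 : ‖p‖ ^ 2 = ∫ x in Ω, (‖p.fn x‖ ^ 2 + ∑ i, ‖p.grad i x‖ ^ 2) := by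
    rw [integral_add (integrable_norm_sq_L2 _)
      (integrable_finsetSum _ fun i _ => integrable_norm_sq_L2 _),
      integral_finsetSum _ fun i _ => integrable_norm_sq_L2 _, Jet.norm_sq]
    simp only [integral_norm_sq_L2]
  rw [h1, scalarForm_apply, ← integral_const_mul]
  simp only [L2.inner_def]
  rw [← integral_finsetSum _ fun i _ => L2.integrable_inner _ _,
    ← integral_add (integrable_finsetSum _ fun i _ => L2.integrable_inner _ _)
      (L2.integrable_inner _ _)]
  refine integral_mono_ae ?_ ?_ ?_
  · exact ((integrable_norm_sq_L2 _).add
      (integrable_finsetSum _ fun i _ => integrable_norm_sq_L2 _)).const_mul _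
  · exact (integrable_finsetSum _ fun i _ => L2.integrable_inner _ _).add
      (L2.integrable_inner _ _)
  · filter_upwards [ae_restrict_mem hΩ.measurableSet, coeFn_lowerOrder hΩ hbdd s p,
      ae_all_iff.2 fun i => coeFn_weightL hΩ hbdd (p.grad i)] with x hx h2 h3
    simp only [h2, h3]
    exact constH_mul_le_pointwise hn hm0 (hm x hx) (hM x hx) s _ _

/-! ### The weak Dirichlet problem -/

/-- The Lax-Milgram theorem on a closed subspace. -/
theorem existsUnique_of_coercive {W : Type*} [NormedAddCommGroup W] [InnerProductSpace ℝ W]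
    [CompleteSpace W] {V : Submodule ℝ W} (hV : IsClosed (V : Set W)) (B : W →L[ℝ] W →L[ℝ] ℝ)
    {C : ℝ} (hC : 0 < C) (hB : ∀ v ∈ V, C * ‖v‖ ^ 2 ≤ B v v) (ℓ : W →L[ℝ] ℝ) :
    ∃! v : V, ∀ w ∈ V, B v w = ℓ w := by
  have : CompleteSpace V := hV.completeSpace_coe
  have hcoer : IsCoercive (B.bilinearComp V.subtypeL V.subtypeL) :=
    ⟨C, hC, fun v => by
      rw [mul_assoc, ← sq]
      exact hB v v.2⟩
  let u : V := (InnerProductSpace.toDual ℝ V).symm (ℓ ∘L V.subtypeL)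
  have hu : ∀ w, ⟪u, w⟫_ℝ = ℓ w := fun w => InnerProductSpace.toDual_symm_apply
  refine ⟨hcoer.continuousLinearEquivOfBilin.symm u, fun w hw => ?_, fun v hv => ?_⟩
  · have := hcoer.continuousLinearEquivOfBilin_apply
      (hcoer.continuousLinearEquivOfBilin.symm u) ⟨w, hw⟩
    rw [ContinuousLinearEquiv.apply_symm_apply, hu] at this
    exact this.symm
  · rw [ContinuousLinearEquiv.eq_symm_apply]
    refine (hcoer.unique_continuousLinearEquivOfBilin fun w => ?_).symm
    rw [hu]
    exact (hv w w.2).symm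

section Weak

variable {n : ℕ} {Ω : Set (E n)}

/-- This turns the Clifford-valued problem into a real one. In the converse direction, testing with
`G a` for every `a` gives all scalar parts `⟨1, u a⟩`, which determine `u`. -/
theorem isWeakSolution_iff (hΩ : IsOpen Ω) (hbdd : Bornology.IsBounded Ω)
    (s : EuclideanSpace ℝ (Fin (n + 1))) (f : L2 n Ω) (F : H10 n Ω) :
    IsWeakSolution s f F ↔ ∀ G : H10 n Ω,
      scalarForm hΩ hbdd s (F : H1 n Ω) (G : H1 n Ω) = ⟪f, ((G : H1 n Ω) : Jet n Ω).fn⟫_ℝ := by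
  constructor
  · intro h G
    rw [← inner_one_qForm, h G, pairing_eq_pairL, inner_one_pairL]
  · intro h G
    refine eq_of_inner_one_mul fun a => ?_
    have h1 : ((H10.rightMul a G : H10 n Ω) : H1 n Ω) = H1.rightMul a G := rfl
    have h2 := h (H10.rightMul a G)
    rw [h1, ← inner_one_qForm, qForm_rightMul hΩ hbdd] at h2
    rw [h2, pairing_eq_pairL, ← pairL_rightMul, inner_one_pairL]
    rfl

theorem normL2_le_norm (F : H1 n Ω) : normL2 F ≤ ‖F‖ := by
  refine le_of_sq_le_sq ?_ (norm_nonneg F)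
  have := Jet.norm_sq (F : Jet n Ω)
  rw [Submodule.coe_norm] at *
  rw [this, normL2]
  have : 0 ≤ ∑ i, ‖(F : Jet n Ω).grad i‖ ^ 2 := Finset.sum_nonneg fun i _ => by positivity
  linarith

theorem seminormD_le_norm (F : H1 n Ω) : seminormD F ≤ ‖F‖ := by
  refine Real.sqrt_le_iff.2 ⟨norm_nonneg F, ?_⟩
  have := Jet.norm_sq (F : Jet n Ω)
  rw [Submodule.coe_norm, this]
  have : 0 ≤ ‖(F : Jet n Ω).fn‖ ^ 2 := by positivity
  linarith

/-- Testing with `F` itself gives `H ‖F‖² ≤ ⟨f, F⟩ ≤ ‖f‖ ‖F‖` in the full `H¹` norm. -/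
theorem norm_le_of_isWeakSolution (hn : 1 ≤ n) (hΩ : IsOpen Ω) (hbdd : Bornology.IsBounded Ω)
    {m M : ℝ} (hm0 : 0 ≤ m) (hm : ∀ x ∈ Ω, m ≤ ‖x‖) (hM : ∀ x ∈ Ω, ‖x‖ ≤ M)
    {s : EuclideanSpace ℝ (Fin (n + 1))} (hH : 0 < constH n m M s) {f : L2 n Ω} {F : H10 n Ω}
    (hF : IsWeakSolution s f F) : ‖(F : H1 n Ω)‖ ≤ 1 / constH n m M s * ‖f‖ := by
  have h1 := constH_mul_norm_sq_le hn hΩ hbdd hm0 hm hM s ((F : H1 n Ω) : Jet n Ω)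
  rw [(isWeakSolution_iff hΩ hbdd s f F).1 hF F, ← Submodule.coe_norm] at h1
  have h2 : ⟪f, ((F : H1 n Ω) : Jet n Ω).fn⟫_ℝ ≤ ‖f‖ * ‖(F : H1 n Ω)‖ :=
    (real_inner_le_norm _ _).trans
      (mul_le_mul_of_nonneg_left (normL2_le_norm (F : H1 n Ω)) (norm_nonneg f))
  rw [one_div, ← div_eq_inv_mul, le_div_iff₀ hH]
  -- The factor `‖F‖` can be cancelled only when it is nonzero.
  rcases (norm_nonneg (F : H1 n Ω)).eq_or_lt with h | h
  · rw [← h, zero_mul]; exact norm_nonneg f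
  · refine le_of_mul_le_mul_right ?_ h
    linarith

theorem existsUnique_isWeakSolution (hn : 1 ≤ n) (hΩ : IsOpen Ω) (hbdd : Bornology.IsBounded Ω)
    {m M : ℝ} (hm0 : 0 ≤ m) (hm : ∀ x ∈ Ω, m ≤ ‖x‖) (hM : ∀ x ∈ Ω, ‖x‖ ≤ M)
    {s : EuclideanSpace ℝ (Fin (n + 1))} (hH : 0 < constH n m M s) (f : L2 n Ω) :
    ∃! F : H10 n Ω, IsWeakSolution s f F := by
  obtain ⟨⟨p, F, hF, rfl⟩, h1, h2⟩ := existsUnique_of_coercive (isClosed_jetH10 n Ω)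
    (scalarForm hΩ hbdd s) hH (fun p _ => constH_mul_norm_sq_le hn hΩ hbdd hm0 hm hM s p)
    (innerSL ℝ f ∘L fnL n Ω)
  refine ⟨⟨F, hF⟩, (isWeakSolution_iff hΩ hbdd s f _).2 fun G => h1 _ (coe_mem_jetH10 G),
    fun F' hF' => ?_⟩
  have h3 := h2 ⟨(F' : H1 n Ω), coe_mem_jetH10 F'⟩ (by
    rintro - ⟨G, hG, rfl⟩
    exact (isWeakSolution_iff hΩ hbdd s f F').1 hF' ⟨G, hG⟩)
  have h4 : ((F' : H1 n Ω) : Jet n Ω) = (F : Jet n Ω) :=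
    congrArg (fun v : jetH10 n Ω => (v : Jet n Ω)) h3
  exact Subtype.ext (Subtype.ext h4)

end Weak

/-! ### Positivity of `H` and the main theorem -/

/-- The second hypothesis is `c² < a b` written out with `|s|² = s₀² + |s̲|²`, where `s̲ = (s₁, …,
s_n)`. -/
theorem constH_pos {n : ℕ} {m M : ℝ} {s : EuclideanSpace ℝ (Fin (n + 1))}
    (hs1 : ‖s‖ ^ 2 + n ^ 2 - 2 * |s 0| * n * M + (1 + m ^ 2) ^ 2 > 0)
    (hs2 : (∑ i : Fin n, s i.succ ^ 2) * (1 + m ^ 2) ^ 2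
        - s 0 ^ 2 * (n * (1 + M ^ 2) ^ 2 - (1 + m ^ 2) ^ 2)
        - 2 * n * M * ((3 + n) * (1 + M ^ 2) ^ 2 + (1 + m ^ 2) ^ 2) * |s 0|
      > n * (3 + n) ^ 2 * M ^ 2 * (1 + M ^ 2) ^ 2 - n ^ 2 * (1 + m ^ 2) ^ 2) :
    0 < constH n m M s := by
  refine min_eigenvalue_pos hs1 ?_
  have h1 : ‖s‖ ^ 2 = s 0 ^ 2 + ∑ i : Fin n, s i.succ ^ 2 := by
    rw [EuclideanSpace.real_norm_sq_eq, Fin.sum_univ_succ]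
  have h2 : √(n : ℝ) ^ 2 = n := Real.sq_sqrt (Nat.cast_nonneg n)
  have h3 : (√n * (1 + M ^ 2) * ((3 + n) * M + |s 0|)) ^ 2 =
      n * (1 + M ^ 2) ^ 2 * ((3 + n) ^ 2 * M ^ 2 + 2 * (3 + n) * M * |s 0| + s 0 ^ 2) := by
    linear_combination (1 + M ^ 2) ^ 2 * ((3 + n) * M + |s 0|) ^ 2 * h2 +
      n * (1 + M ^ 2) ^ 2 * sq_abs (s 0)
  rw [h3, h1]
  linarith

end SphericalDirac

end

open SphericalDirac in
theorem mainTheorem5 (n : ℕ) (hn : 2 ≤ n) (Ω : Set (E n)) (hΩ : IsOpen Ω)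
    (hbdd : Bornology.IsBounded Ω) (hsmooth : HasSmoothBoundary Ω)
    (m M : ℝ) (hm0 : 0 ≤ m) (hmM : m < M)
    (hm : IsGLB ((fun x : E n => ‖x‖) '' Ω) m) (hM : IsLUB ((fun x : E n => ‖x‖) '' Ω) M)
    (s : EuclideanSpace ℝ (Fin (n + 1)))
    (hs1 : ‖s‖ ^ 2 + n ^ 2 - 2 * |s 0| * n * M + (1 + m ^ 2) ^ 2 > 0)
    (hs2 : (∑ i : Fin n, s i.succ ^ 2) * (1 + m ^ 2) ^ 2
        - s 0 ^ 2 * (n * (1 + M ^ 2) ^ 2 - (1 + m ^ 2) ^ 2)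
        - 2 * n * M * ((3 + n) * (1 + M ^ 2) ^ 2 + (1 + m ^ 2) ^ 2) * |s 0|
      > n * (3 + n) ^ 2 * M ^ 2 * (1 + M ^ 2) ^ 2 - n ^ 2 * (1 + m ^ 2) ^ 2) :
    0 < constH n m M s ∧
    ∀ f : L2 n Ω, (∃! F : H10 n Ω, IsWeakSolution s f F) ∧
      ∀ F : H10 n Ω, IsWeakSolution s f F →
        normL2 (F : H1 n Ω) ≤ 1 / constH n m M s * ‖f‖ ∧
        seminormD (F : H1 n Ω) ≤ 1 / constH n m M s * ‖f‖ := by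
  have hH := constH_pos hs1 hs2
  have hn1 : 1 ≤ n := by omega
  have hmx : ∀ x ∈ Ω, m ≤ ‖x‖ := fun x hx => hm.1 ⟨x, hx, rfl⟩
  have hMx : ∀ x ∈ Ω, ‖x‖ ≤ M := fun x hx => hM.1 ⟨x, hx, rfl⟩
  refine ⟨hH, fun f => ⟨existsUnique_isWeakSolution hn1 hΩ hbdd hm0 hmx hMx hH f,
    fun F hF => ?_⟩⟩
  have h := norm_le_of_isWeakSolution hn1 hΩ hbdd hm0 hmx hMx hH hF
  -- Both `‖F‖_2` and `‖F‖_D` are dominated by the `H¹` norm.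
  exact ⟨(normL2_le_norm _).trans h, (seminormD_le_norm _).trans h⟩
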